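/- Let $K$ be a number field of degree $n=s+2t$ with $t>0$, with real embeddings $\sigma_1,\dots,\sigma_s$ and with $2t$ non-real embeddings into $\mathbb C$; let $\sigma_{s+1},\dots,\sigma_{s+t}$ be a choice of one embedding out of each pair of complex conjugate non-real ones. Let $\mathcal O_K$ be the ring of integers of $K$ and $\mathcal O_K^{*,+}$ the group of units that are positive in all real embeddings. Let $U\subset\mathcal O_K^{*,+}$ be an admissible subgroup, that is, $u\mapsto(\log\sigma_1(u),\dots,\log\sigma_s(u))$ maps $U$ isomorphically onto a lattice of full rank in $\mathbb R^s$. The group $\Gamma=\mathcal O_K\rtimes U$ acts on $\mathbb H^s\times\mathbb C^t$ ($\mathbb H$ is the upper half-plane) by letting $a\in\mathcal O_K$ and $u\in U$ act as $$T_a(z_i)=(z_i+\sigma_i(a)),\qquad R_u(z_i)=(\sigma_i(u)z_i),\qquad i=1,\dots,s+t.$$ Let $M_K=(\mathbb H^s\times\mathbb C^t)/\Gamma$ be the corresponding Oeljeklaus–Toma manifold, with the quotient topology and complex structure, and let $\pi:\mathbb H^s\times\mathbb C^t\to M_K$ be the quotient map. Let $\Sigma$ be the holomorphic foliation on $M_K$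 whose pullback to $\mathbb H^s\times\mathbb C^t$ is spanned by $\partial/\partial z_{s+1},\dots,\partial/\partial z_{s+t}$. Let $Z$ be the closure in $M_K$ of a leaf of $\Sigma$. Then: (i) There are positive real numbers $\alpha_1,\dots,\alpha_s$ such that $\pi^{-1}(Z)$ contains the set $$\{(z_1,\dots,z_{s+t})\in\mathbb H^s\times\mathbb C^t \mid \operatorname{Im} z_i=\alpha_i,\ i=1,\dots,s\}.$$ (ii) Any complex subvariety (closed complex analytic subset) of $M_K$ that contains $Z$ is equal to $M_K$. -/

import Mathlib

open NumberField Topology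

namespace OT

/-- A numbering of the archimedean embeddings of a number field `K`: all the real embeddings
`re 0, …, re (s-1)`, and one embedding `co j` out of every pair of complex conjugate non-real
embeddings. -/
structure Embeddings (K : Type*) [Field K] (s t : ℕ) where
  re : Fin s → (K →+* ℝ)
  co : Fin t → (K →+* ℂ)
  re_bijective : Function.Bijective re
  co_not_real : ∀ j, ¬ ComplexEmbedding.IsReal (co j)
  co_existsUnique : ∀ φ : K →+* ℂ, ¬ ComplexEmbedding.IsReal φ →
    ∃! j, co j = φ ∨ co j = ComplexEmbedding.conjugate φ

/-- The group of units of the ring of integers that are positive in all real embeddings. -/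
def positiveUnits (K : Type*) [Field K] : Subgroup (𝓞 K)ˣ where
  carrier := {u | ∀ τ : K →+* ℝ, 0 < τ ((u : 𝓞 K) : K)}
  one_mem' := by intro τ; simp
  mul_mem' := by
    intro u v hu hv τ
    simpa using mul_pos (hu τ) (hv τ)
  inv_mem' := by
    intro u hu τ
    have h : τ ((u : 𝓞 K) : K) * τ (((u⁻¹ : (𝓞 K)ˣ) : 𝓞 K) : K) = 1 := by
      rw [← map_mul, ← map_mul, Units.mul_inv, map_one, map_one]
    exact pos_of_mul_pos_right (h ▸ one_pos) (hu τ).le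

variable {K : Type*} [Field K] {s t : ℕ}

/-- The element of `K` underlying an element of a group of positive units. -/
def unitVal {U : Subgroup (positiveUnits K)} (u : U) : K :=
  (((u : positiveUnits K) : (𝓞 K)ˣ) : 𝓞 K)

theorem unitVal_one {U : Subgroup (positiveUnits K)} : unitVal (1 : U) = 1 := by
  simp [unitVal]

theorem unitVal_mul {U : Subgroup (positiveUnits K)} (u v : U) :
    unitVal (u * v) = unitVal u * unitVal v := by
  simp [unitVal]

theorem unitVal_pos {U : Subgroup (positiveUnits K)} (u : U) (τ : K →+* ℝ) :
    0 < τ (unitVal u) :=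
  u.1.2 τ

/-- The logarithmic map `u ↦ (log σ₁(u), …, log σ_s(u))` of the real embeddings. -/
noncomputable def logMap (σ : Embeddings K s t) (U : Subgroup (positiveUnits K)) (u : U) :
    Fin s → ℝ :=
  fun i => Real.log (σ.re i (unitVal u))

/-- A group `U` of positive units is admissible if the logarithms of the real embeddings map it
isomorphically onto a lattice of full rank in `ℝ^s`. (If `s > 0`, injectivity is automatic.) -/
def IsAdmissible (σ : Embeddings K s t) (U : Subgroup (positiveUnits K)) : Prop :=
  Function.Injective (logMap σ U) ∧
    ∃ b : Module.Basis (Fin s) ℝ (Fin s → ℝ),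
      Set.range (logMap σ U) = (Submodule.span ℤ (Set.range b) : Set (Fin s → ℝ))

/-- The action of `U` on the additive group of `𝓞 K` by multiplication. -/
def unitAction (U : Subgroup (positiveUnits K)) : U →* MulAut (Multiplicative (𝓞 K)) :=
  (MulAutMultiplicative (𝓞 K)).symm.toMonoidHom.comp (DistribMulAction.toAddAut U (𝓞 K))

/-- The group `Γ = 𝓞 K ⋊ U`. -/
abbrev Gam (U : Subgroup (positiveUnits K)) : Type _ :=
  Multiplicative (𝓞 K) ⋊[unitAction U] U

/-- The vector space `ℂ^s × ℂ^t`. -/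
abbrev Ambient (s t : ℕ) : Type := (Fin s → ℂ) × (Fin t → ℂ)

/-- `ℍ^s × ℂ^t`, as an open subset of `ℂ^s × ℂ^t`. -/
def Cover (_σ : Embeddings K s t) : Type :=
  {z : Ambient s t // ∀ i, 0 < (z.1 i).im}

instance (σ : Embeddings K s t) : TopologicalSpace (Cover σ) :=
  inferInstanceAs (TopologicalSpace {z : Ambient s t // ∀ i, 0 < (z.1 i).im})

/-- The point `T_a (R_u z)` whose coordinates are `σ_i(u) z_i + σ_i(a)`. -/
def affineAct (σ : Embeddings K s t) {U : Subgroup (positiveUnits K)} (a : 𝓞 K) (u : U)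
    (z : Cover σ) : Cover σ :=
  ⟨(fun i => (σ.re i (unitVal u) : ℂ) * z.1.1 i + (σ.re i (a : K) : ℂ),
    fun j => σ.co j (unitVal u) * z.1.2 j + σ.co j (a : K)), by
    intro i
    have h := mul_pos (unitVal_pos u (σ.re i)) (z.2 i)
    simpa using h⟩

theorem unitAction_apply (U : Subgroup (positiveUnits K)) (u : U) (a : Multiplicative (𝓞 K)) :
    ((Multiplicative.toAdd (unitAction U u a) : 𝓞 K) : K) =
      unitVal u * ((Multiplicative.toAdd a : 𝓞 K) : K) := by
  change algebraMap (𝓞 K) K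
    ((((u : positiveUnits K) : (𝓞 K)ˣ) : 𝓞 K) * Multiplicative.toAdd a) = _
  rw [map_mul]
  rfl

/-- The action of `Γ` on `ℍ^s × ℂ^t`: the pair `(a, u)` acts as `T_a ∘ R_u`. -/
instance (σ : Embeddings K s t) (U : Subgroup (positiveUnits K)) :
    MulAction (Gam U) (Cover σ) where
  smul g z := affineAct σ (Multiplicative.toAdd g.left) g.right z
  one_smul z := by
    apply Subtype.ext
    change (affineAct σ (Multiplicative.toAdd (1 : Gam U).left) (1 : Gam U).right z).1 = z.1
    refine Prod.ext ?_ ?_ <;> funext i <;> simp [affineAct, unitVal_one]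
  mul_smul g h z := by
    apply Subtype.ext
    change (affineAct σ (Multiplicative.toAdd (g * h).left) (g * h).right z).1 =
      (affineAct σ (Multiplicative.toAdd g.left) g.right
        (affineAct σ (Multiplicative.toAdd h.left) h.right z)).1
    refine Prod.ext ?_ ?_ <;> funext i <;>
      simp [affineAct, unitVal_mul, unitAction_apply] <;> ring

/-- The Oeljeklaus-Toma manifold `M_K = (ℍ^s × ℂ^t) / Γ` (for admissible `U`), with the quotient
topology. -/
def Manifold (σ : Embeddings K s t) (U : Subgroup (positiveUnits K)) : Type :=
  MulAction.orbitRel.Quotient (Gam U) (Cover σ)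

instance (σ : Embeddings K s t) (U : Subgroup (positiveUnits K)) :
    TopologicalSpace (Manifold σ U) :=
  inferInstanceAs (TopologicalSpace (Quotient (MulAction.orbitRel (Gam U) (Cover σ))))

/-- The quotient map `ℍ^s × ℂ^t → M_K`. -/
def proj (σ : Embeddings K s t) (U : Subgroup (positiveUnits K)) (z : Cover σ) : Manifold σ U :=
  Quotient.mk (MulAction.orbitRel (Gam U) (Cover σ)) z

variable {σ : Embeddings K s t} {U : Subgroup (positiveUnits K)}

/-- The complex structure of `M_K` is the quotient one: a function on an open set `V` is
holomorphic if its pullback to the open subset `π⁻¹(V)` of `ℍ^s × ℂ^t ⊆ ℂ^s × ℂ^t` is. Only the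
values of `f` on `V` and those of `F` on `π⁻¹(V)` matter. -/
def IsHolomorphicOn (f : Manifold σ U → ℂ) (V : Set (Manifold σ U)) : Prop :=
  ∃ F : Ambient s t → ℂ,
    DifferentiableOn ℂ F {x | ∃ z : Cover σ, z.1 = x ∧ proj σ U z ∈ V} ∧
      ∀ z : Cover σ, proj σ U z ∈ V → F z.1 = f (proj σ U z)

/-- A complex subvariety (closed complex analytic subset) of `M_K`: near every point of `M_K`,
it is the set of common zeros of finitely many holomorphic functions. -/
def IsSubvariety (X : Set (Manifold σ U)) : Prop :=
  ∀ p : Manifold σ U, ∃ V : Set (Manifold σ U), IsOpen V ∧ p ∈ V ∧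
    ∃ (k : ℕ) (f : Fin k → Manifold σ U → ℂ), (∀ i, IsHolomorphicOn (f i) V) ∧
      X ∩ V = {q | q ∈ V ∧ ∀ i, f i q = 0}

/-- The complex span of `∂/∂z_{s+1}, …, ∂/∂z_{s+t}`: the tangent space, at every point of
`ℍ^s × ℂ^t`, of the foliation that is the pullback of `Σ`. -/
def nullSpace (s t : ℕ) : Submodule ℂ (Ambient s t) :=
  Submodule.span ℂ (Set.range fun j : Fin t => ((0, Pi.single j 1) : Ambient s t))

/-- `p` and `q` are the end points of a `C¹` path in `M_K` that is tangent to `Σ`, the path being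
given by a lift to `ℍ^s × ℂ^t`. -/
def TangentJoined (p q : Manifold σ U) : Prop :=
  ∃ c : ℝ → Ambient s t, ContDiff ℝ 1 c ∧
    (∀ r ∈ Set.Icc (0 : ℝ) 1, deriv c r ∈ nullSpace s t) ∧
    (∀ r ∈ Set.Icc (0 : ℝ) 1, ∀ i, 0 < ((c r).1 i).im) ∧
    (∃ z : Cover σ, z.1 = c 0 ∧ proj σ U z = p) ∧
    ∃ z : Cover σ, z.1 = c 1 ∧ proj σ U z = q

/-- A leaf of `Σ`: the set of all points that can be reached from some point `p` of `M_K` by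
piecewise `C¹` paths tangent to `Σ`. -/
def IsLeaf (L : Set (Manifold σ U)) : Prop :=
  ∃ p : Manifold σ U, L = {q | Relation.EqvGen TangentJoined p q}

end OT

/-!
The leaf through `π(z₀)` is the image of `{z₀.1} × ℂ^t`. Translations by the integers `a ∈ 𝓞 K`
alone show that its preimage contains every point whose coordinates in `ℍ^s` are
`z₀.1 + (σ₁(a), …, σ_s(a))`.

Since `K` has a non-real embedding, `(σ₁, …, σ_s)` maps `𝓞 K` onto a *dense* subgroup of `ℝ^s`
(`exists_integer_re_near`). By Minkowski's theorem there is a nonzero integer `a` that is small at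
all real places, at the expense of one complex place. The full lattice `𝓞 K` is cobounded in
`K ⊗ ℝ`, so its multiple `a 𝓞 K` meets every ball of `ℝ^s` whose radius is a fixed multiple of the
size of `a`. Hence the preimage of the closure of the leaf contains all `z` with
`Im z_i = Im (z₀)_i` for `i ≤ s`.

A holomorphic function that vanishes on such a set vanishes on the ball around any of its points:
restrict it to complex lines in which the set cuts out a real line
(`DifferentiableOn.eq_zero_on_ball_of_im_eq`). So the preimage of a subvariety that contains the
closure of the leaf has nonempty interior, and by the identity theorem and the connectedness of
`ℍ^s × ℂ^t` it is everything (`subset_of_locally_zeroLocus`).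
-/

open Filter NumberField.InfinitePlace NumberField.mixedEmbedding

/-! ### Density of the integers at the real places -/

/-- Minkowski's theorem: the box can be made thin at all places but one, if it is long enough at
that one for its volume to reach the Minkowski bound. -/
theorem NumberField.exists_ne_zero_integer_lt_of_ne (K : Type*) [Field K] [NumberField K]
    (w₁ : InfinitePlace K) {ε : ℝ} (hε : 0 < ε) :
    ∃ a : 𝓞 K, a ≠ 0 ∧ ∀ w : InfinitePlace K, w ≠ w₁ → w (a : K) < ε := by
  classical
  let B : NNReal := (minkowskiBound K ↑1).toNNReal + 1
  obtain ⟨g, hg, hprod⟩ := adjust_f K (f := fun _ => ε.toNNReal) (w₁ := w₁) B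
    (fun w _ => (Real.toNNReal_pos.mpr hε).ne')
  have hvol : minkowskiBound K ↑1 < MeasureTheory.volume (convexBodyLT K g) := by
    have h1 : ((minkowskiBound K ↑1).toNNReal : ENNReal) = minkowskiBound K ↑1 :=
      ENNReal.coe_toNNReal (minkowskiBound_lt_top K ↑1).ne
    rw [convexBodyLT_volume, ← h1]
    rw [hprod, ← ENNReal.coe_mul, ENNReal.coe_lt_coe]
    calc (minkowskiBound K ↑1).toNNReal < 1 * B := by
          rw [one_mul]; exact lt_add_of_pos_right _ one_pos
      _ ≤ convexBodyLTFactor K * B :=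
          mul_le_mul_of_nonneg_right (one_le_convexBodyLTFactor K) zero_le
  obtain ⟨a, ha, hlt⟩ := exists_ne_zero_mem_ringOfIntegers_lt K hvol
  refine ⟨a, ha, fun w hw => ?_⟩
  have := hlt w
  rwa [hg w hw, Real.coe_toNNReal _ hε.le] at this

/-- The ring of integers is cobounded in the mixed space, as seen by the real coordinates. -/
theorem NumberField.exists_bound_integer_near (K : Type*) [Field K] [NumberField K] :
    ∃ C : ℝ, 0 ≤ C ∧ ∀ y : mixedSpace K, ∃ b : 𝓞 K, ∀ w : {w : InfinitePlace K // IsReal w},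
      |y.1 w - embedding_of_isReal w.2 (b : K)| ≤ C := by
  classical
  refine ⟨∑ i, ‖latticeBasis K i‖, Finset.sum_nonneg fun i _ => norm_nonneg _, fun y => ?_⟩
  obtain ⟨b, hb⟩ := (mem_span_latticeBasis K).mp (ZSpan.floor (latticeBasis K) y).2
  replace hb : mixedEmbedding K (b : K) = ZSpan.floor (latticeBasis K) y := hb
  refine ⟨b, fun w => ?_⟩
  have h := (norm_le_pi_norm _ w).trans
    ((norm_fst_le _).trans (ZSpan.norm_fract_le (latticeBasis K) y))
  rwa [ZSpan.fract_apply, ← hb, Prod.fst_sub, Pi.sub_apply, mixedEmbedding_apply_isReal,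
    Real.norm_eq_abs] at h

namespace OT

theorem isReal_ofReal_comp {K : Type*} [Field K] (τ : K →+* ℝ) :
    ComplexEmbedding.IsReal (Complex.ofRealHom.comp τ) := by
  rw [ComplexEmbedding.isReal_iff]
  ext x
  simp [ComplexEmbedding.conjugate]

/-- If there is a non-real embedding, the image of the ring of integers under the real embeddings
is dense. -/
theorem exists_integer_re_near {K : Type*} [Field K] [NumberField K] {s t : ℕ} (ht : 0 < t)
    (σ : Embeddings K s t) (x : Fin s → ℝ) {ε : ℝ} (hε : 0 < ε) :
    ∃ a : 𝓞 K, ∀ i, |x i - σ.re i (a : K)| < ε := by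
  obtain ⟨C, hC, hnear⟩ := NumberField.exists_bound_integer_near K
  have hw₁ : ¬ IsReal (InfinitePlace.mk (σ.co ⟨0, ht⟩)) :=
    fun h => σ.co_not_real _ (isReal_mk_iff.mp h)
  obtain ⟨a, ha, hsmall⟩ := NumberField.exists_ne_zero_integer_lt_of_ne K
    (InfinitePlace.mk (σ.co ⟨0, ht⟩)) (div_pos hε (by linarith : 0 < C + 1))
  have hreal : ∀ i, IsReal (InfinitePlace.mk (Complex.ofRealHom.comp (σ.re i))) :=
    fun i => isReal_mk_iff.mpr (isReal_ofReal_comp _)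
  have hemb : ∀ i, embedding_of_isReal (hreal i) = σ.re i := by
    intro i
    ext c
    apply Complex.ofReal_injective
    rw [embedding_of_isReal_apply, embedding_mk_eq_of_isReal (isReal_ofReal_comp _)]
    rfl
  let e := Equiv.ofBijective σ.re σ.re_bijective
  let y : mixedSpace K := (fun w => x (e.symm (embedding_of_isReal w.2)) /
    embedding_of_isReal w.2 (a : K), 0)
  obtain ⟨b, hb⟩ := hnear y
  refine ⟨a * b, fun i => ?_⟩
  have hai : σ.re i (a : K) ≠ 0 := by
    rw [map_ne_zero]
    exact RingOfIntegers.coe_ne_zero_iff.mpr ha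
  have h1 : |x i / σ.re i (a : K) - σ.re i (b : K)| ≤ C := by
    have h := hb ⟨_, hreal i⟩
    have hi : e.symm (σ.re i) = i := e.symm_apply_apply i
    simpa only [y, hemb, hi] using h
  have h2 : |σ.re i (a : K)| < ε / (C + 1) := by
    have h := hsmall (InfinitePlace.mk (Complex.ofRealHom.comp (σ.re i)))
      (fun h => hw₁ (h ▸ hreal i))
    simpa [InfinitePlace.apply] using h
  have h3 : x i - σ.re i ((a * b : 𝓞 K) : K) =
      σ.re i (a : K) * (x i / σ.re i (a : K) - σ.re i (b : K)) := by
    have h : ((a * b : 𝓞 K) : K) = (a : K) * (b : K) := map_mul _ _ _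
    rw [h, map_mul]
    field_simp
  rw [h3, abs_mul]
  calc |σ.re i (a : K)| * |x i / σ.re i (a : K) - σ.re i (b : K)|
      ≤ ε / (C + 1) * C := mul_le_mul h2.le h1 (abs_nonneg _) (by positivity)
    _ < ε / (C + 1) * (C + 1) := mul_lt_mul_of_pos_left (by linarith) (by positivity)
    _ = ε := by field_simp

end OT

/-! ### Zeros of holomorphic functions of several variables -/

section ZeroLocus

variable {E : Type*} [NormedAddCommGroup E] [NormedSpace ℂ E]

/-- The identity theorem along the complex line `z ↦ p + z • v`. -/
theorem DifferentiableOn.eq_zero_of_frequently_eq_zero_on_line {F : E → ℂ} {B : Set E}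
    (hF : DifferentiableOn ℂ F B) (hB : IsOpen B) (hconv : Convex ℝ B) {p v : E} {c : ℂ}
    (hp : p ∈ B) (hc : p + c • v ∈ B) (hzero : ∃ᶠ z : ℂ in 𝓝[≠] 0, F (p + z • v) = 0) :
    F (p + c • v) = 0 := by
  let l : ℂ → E := fun z => p + z • v
  have hl : Differentiable ℂ l := by fun_prop
  have hopen : IsOpen (l ⁻¹' B) := hB.preimage hl.continuous
  have hpre : IsPreconnected (l ⁻¹' B) :=
    ((hconv.translate_preimage_right p).linear_preimage
      ((LinearMap.toSpanSingleton ℂ E v).restrictScalars ℝ)).isPreconnected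
  have han : AnalyticOnNhd ℂ (F ∘ l) (l ⁻¹' B) :=
    (hF.comp hl.differentiableOn (fun _ h => h)).analyticOnNhd hopen
  exact han.eqOn_zero_of_preconnected_of_frequently_eq_zero hpre
    (z₀ := 0) (by simpa [l] using hp) hzero hc

theorem DifferentiableOn.eqOn_zero_of_eventuallyEq_zero {F : E → ℂ} {B : Set E}
    (hF : DifferentiableOn ℂ F B) (hB : IsOpen B) (hconv : Convex ℝ B) {p : E}
    (hp : p ∈ B) (hzero : F =ᶠ[𝓝 p] 0) : Set.EqOn F 0 B := by
  intro q hq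
  have h := hF.eq_zero_of_frequently_eq_zero_on_line hB hconv (v := q - p) (c := 1) hp
    (by simpa using hq) ?_
  · simpa using h
  · have ht : Tendsto (fun z : ℂ => p + z • (q - p)) (𝓝[≠] 0) (𝓝 p) := by
      have : Continuous fun z : ℂ => p + z • (q - p) := by fun_prop
      simpa using (this.tendsto 0).mono_left nhdsWithin_le_nhds
    exact (ht.eventually hzero).frequently

/-- The set `{Im z_i = α_i}` is generic: a holomorphic function on a ball around one of its points
that vanishes on it is zero. -/
theorem DifferentiableOn.eq_zero_on_ball_of_im_eq {ι : Type*} [Fintype ι]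
    {F : (ι → ℂ) × E → ℂ} {p : (ι → ℂ) × E} {r : ℝ}
    (hF : DifferentiableOn ℂ F (Metric.ball p r))
    (hzero : ∀ x ∈ Metric.ball p r, (∀ i, (x.1 i).im = (p.1 i).im) → F x = 0) :
    Set.EqOn F 0 (Metric.ball p r) := by
  intro x hx
  -- `q` is the point of the real set below `x`; the line `q + z • v` lies in the real set for
  -- real `z` and passes through `x` at `z = I`.
  let q : (ι → ℂ) × E := (fun i => (x.1 i).re + (p.1 i).im * Complex.I, x.2)
  let v : (ι → ℂ) × E := (fun i => (((x.1 i).im - (p.1 i).im : ℝ) : ℂ), 0)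
  have hxq : q + Complex.I • v = x := by
    refine Prod.ext (funext fun i => ?_) (by simp [q, v])
    apply Complex.ext <;> simp [q, v]
  have hq : q ∈ Metric.ball p r := by
    rw [Metric.mem_ball] at hx ⊢
    refine lt_of_le_of_lt ?_ hx
    rw [Prod.dist_eq, Prod.dist_eq]
    refine max_le_max ((dist_pi_le_iff dist_nonneg).mpr fun i => ?_) le_rfl
    refine le_trans ?_ (dist_le_pi_dist _ _ i)
    have h : q.1 i - p.1 i = ((x.1 i - p.1 i).re : ℂ) := by
      apply Complex.ext <;> simp [q]
    rw [dist_eq_norm, dist_eq_norm, h, Complex.norm_real]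
    exact Complex.abs_re_le_norm _
  have h := hF.eq_zero_of_frequently_eq_zero_on_line Metric.isOpen_ball (convex_ball p r)
    (v := v) (c := Complex.I) hq (by rwa [hxq]) ?_
  · rwa [hxq] at h
  · have hcont : Continuous fun z : ℝ => q + (z : ℂ) • v := by fun_prop
    have hev : ∀ᶠ z : ℝ in 𝓝[≠] 0, F (q + (z : ℂ) • v) = 0 := by
      have hmem : ∀ᶠ z : ℝ in 𝓝 0, q + (z : ℂ) • v ∈ Metric.ball p r :=
        hcont.continuousAt.eventually_mem (Metric.isOpen_ball.mem_nhds (by simpa using hq))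
      filter_upwards [hmem.filter_mono nhdsWithin_le_nhds] with z hz
      exact hzero _ hz fun i => by simp [q, v]
    have ht : Tendsto ((↑) : ℝ → ℂ) (𝓝[≠] 0) (𝓝[≠] 0) := by
      refine tendsto_nhdsWithin_iff.mpr ⟨?_, ?_⟩
      · simpa using (Complex.continuous_ofReal.tendsto 0).mono_left nhdsWithin_le_nhds
      · filter_upwards [self_mem_nhdsWithin] with z hz
        simpa using hz
    exact ht.frequently hev.frequently

/-- An analytic subset of a connected set with nonempty interior is the whole set. -/
theorem subset_of_locally_zeroLocus {Ω S : Set E} (hΩ : IsPreconnected Ω)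
    (hloc : ∀ p ∈ Ω, ∃ r > 0, ∃ (k : ℕ) (F : Fin k → E → ℂ),
      (∀ i, DifferentiableOn ℂ (F i) (Metric.ball p r)) ∧
        ∀ x ∈ Metric.ball p r, (x ∈ S ↔ ∀ i, F i x = 0))
    (hne : (Ω ∩ interior S).Nonempty) : Ω ⊆ S := by
  refine (hΩ.subset_of_closure_inter_subset isOpen_interior hne ?_).trans interior_subset
  rintro p ⟨hp, hpΩ⟩
  obtain ⟨r, hr, k, F, hF, hS⟩ := hloc p hpΩ
  obtain ⟨q, hqB, hq⟩ := mem_closure_iff.mp hp _ Metric.isOpen_ball (Metric.mem_ball_self hr)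
  refine mem_interior.mpr ⟨Metric.ball p r, fun x hx => (hS x hx).mpr fun i => ?_,
    Metric.isOpen_ball, Metric.mem_ball_self hr⟩
  refine (hF i).eqOn_zero_of_eventuallyEq_zero Metric.isOpen_ball (convex_ball p r) hqB ?_ hx
  filter_upwards [Metric.isOpen_ball.mem_nhds hqB, isOpen_interior.mem_nhds hq] with y hy hyS
  exact (hS y hy).mp (interior_subset hyS) i

end ZeroLocus

/-! ### The quotient and its subvarieties -/

namespace OT

variable {K : Type*} [Field K] {s t : ℕ} {σ : Embeddings K s t} {U : Subgroup (positiveUnits K)}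

theorem continuous_proj : Continuous (proj σ U) := continuous_quot_mk

theorem proj_surjective : Function.Surjective (proj σ U) := Quotient.mk_surjective

theorem proj_affineAct (a : 𝓞 K) (u : U) (z : Cover σ) :
    proj σ U (affineAct σ a u z) = proj σ U z :=
  Quotient.sound (s := MulAction.orbitRel (Gam U) (Cover σ))
    ⟨(⟨Multiplicative.ofAdd a, u⟩ : Gam U), rfl⟩

theorem isOpen_setOf_im_pos (s t : ℕ) : IsOpen {x : Ambient s t | ∀ i, 0 < (x.1 i).im} := by
  simp only [Set.ofPred_forall]
  exact isOpen_iInter_of_finite fun i => isOpen_lt continuous_const (by fun_prop)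

theorem convex_setOf_im_pos (s t : ℕ) : Convex ℝ {x : Ambient s t | ∀ i, 0 < (x.1 i).im} := by
  intro x hx y hy a b ha hb hab i
  have h : ((a • x + b • y).1 i).im = a * (x.1 i).im + b * (y.1 i).im := by simp
  rw [h]
  rcases ha.eq_or_lt with rfl | ha
  · have : b = 1 := by linarith
    subst this
    simpa using hy i
  · exact add_pos_of_pos_of_nonneg (mul_pos ha (hx i)) (mul_nonneg hb (hy i).le)

/-- The preimage of a subset of `M_K`, seen in `ℂ^s × ℂ^t`. -/
def ambientPreimage (X : Set (Manifold σ U)) : Set (Ambient s t) :=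
  {x | ∃ z : Cover σ, z.1 = x ∧ proj σ U z ∈ X}

theorem val_mem_ambientPreimage {X : Set (Manifold σ U)} {z : Cover σ} :
    z.1 ∈ ambientPreimage X ↔ proj σ U z ∈ X := by
  refine ⟨?_, fun h => ⟨z, rfl, h⟩⟩
  rintro ⟨z', h, h'⟩
  rwa [← Subtype.ext h]

theorem isOpen_ambientPreimage {V : Set (Manifold σ U)} (hV : IsOpen V) :
    IsOpen (ambientPreimage V) := by
  have h := (isOpen_setOf_im_pos s t).isOpenMap_subtype_val _ (hV.preimage continuous_proj)
  convert h using 1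
  ext x
  exact ⟨fun ⟨z, h1, h2⟩ => ⟨z, h2, h1⟩, fun ⟨z, h1, h2⟩ => ⟨z, h2, h1⟩⟩

theorem IsSubvariety.exists_ball {X : Set (Manifold σ U)} (hX : IsSubvariety X)
    {p : Ambient s t} (hp : ∀ i, 0 < (p.1 i).im) :
    ∃ r > 0, ∃ (k : ℕ) (F : Fin k → Ambient s t → ℂ),
      (∀ i, DifferentiableOn ℂ (F i) (Metric.ball p r)) ∧
        ∀ x ∈ Metric.ball p r, (x ∈ ambientPreimage X ↔ ∀ i, F i x = 0) := by
  let z : Cover σ := ⟨p, hp⟩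
  obtain ⟨V, hV, hzV, k, f, hf, hXV⟩ := hX (proj σ U z)
  obtain ⟨r, hr, hball⟩ := Metric.isOpen_iff.mp (isOpen_ambientPreimage hV) p ⟨z, rfl, hzV⟩
  choose F hF hFf using hf
  refine ⟨r, hr, k, F, fun i => (hF i).mono hball, fun x hx => ?_⟩
  obtain ⟨y, rfl, hy⟩ := hball hx
  rw [val_mem_ambientPreimage]
  have h := Set.ext_iff.mp hXV (proj σ U y)
  simp only [Set.mem_inter_iff, hy, and_true, Set.mem_ofPred_eq, true_and] at h
  rw [h]
  exact forall_congr' fun i => by rw [hFf i y hy]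

/-- A subvariety whose preimage contains `{Im z_i = α_i}` is everything. -/
theorem IsSubvariety.eq_univ_of_im_eq {X : Set (Manifold σ U)} (hX : IsSubvariety X)
    {α : Fin s → ℝ} (hα : ∀ i, 0 < α i)
    (h : ∀ z : Cover σ, (∀ i, (z.1.1 i).im = α i) → proj σ U z ∈ X) : X = Set.univ := by
  let p : Ambient s t := (fun i => α i * Complex.I, 0)
  have hpα : ∀ i, (p.1 i).im = α i := fun i => by simp [p]
  have hp : ∀ i, 0 < (p.1 i).im := fun i => (hpα i).symm ▸ hα i
  have hint : p ∈ interior (ambientPreimage X) := by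
    obtain ⟨r, hr, k, F, hF, hS⟩ := hX.exists_ball hp
    refine mem_interior.mpr ⟨Metric.ball p r, fun x hx => (hS x hx).mpr fun i => ?_,
      Metric.isOpen_ball, Metric.mem_ball_self hr⟩
    refine (hF i).eq_zero_on_ball_of_im_eq (fun y hy hyp => ?_) hx
    have hyα : ∀ j, (y.1 j).im = α j := fun j => (hyp j).trans (hpα j)
    exact (hS y hy).mp ⟨⟨y, fun j => (hyα j).symm ▸ hα j⟩, rfl, h _ hyα⟩ i
  have hsub := subset_of_locally_zeroLocus (convex_setOf_im_pos s t).isPreconnected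
    (fun q hq => hX.exists_ball hq) ⟨p, hp, hint⟩
  refine Set.eq_univ_of_forall fun q => ?_
  obtain ⟨z, rfl⟩ := proj_surjective q
  exact val_mem_ambientPreimage.mp (hsub z.2)

/-! ### Leaves -/

theorem mem_nullSpace (w : Fin t → ℂ) : ((0, w) : Ambient s t) ∈ nullSpace s t := by
  have h : ((0, w) : Ambient s t) = ∑ j, w j • ((0, Pi.single j 1) : Ambient s t) := by
    refine Prod.ext ?_ ?_
    · simp [Prod.fst_sum]
    · ext i
      simp [Prod.snd_sum, Finset.sum_apply, Pi.single_apply]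
  rw [h]
  exact Submodule.sum_mem _ fun j _ =>
    Submodule.smul_mem _ _ (Submodule.subset_span ⟨j, rfl⟩)

/-- Points with the same coordinates in `ℍ^s` are joined by a segment tangent to the foliation. -/
theorem tangentJoined_of_fst_eq {z z' : Cover σ} (h : z.1.1 = z'.1.1) :
    TangentJoined (proj σ U z) (proj σ U z') := by
  let v : Ambient s t := (0, z'.1.2 - z.1.2)
  have hderiv : ∀ r : ℝ, HasDerivAt (fun r : ℝ => z.1 + r • v) v r := fun r => by
    simpa using ((hasDerivAt_id r).smul_const v).const_add z.1
  refine ⟨fun r => z.1 + r • v, by fun_prop, fun r _ => ?_, fun r _ i => ?_,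
    ⟨z, by simp, rfl⟩, ⟨z', ?_, rfl⟩⟩
  · rw [(hderiv r).deriv]
    exact mem_nullSpace _
  · simpa [v] using z.2 i
  · refine Prod.ext ?_ ?_ <;> simp [v, h]

/-- The closure of a leaf contains, with a point of `ℍ^s × ℂ^t`, all points whose coordinates in
`ℍ^s` have the same imaginary parts. -/
theorem proj_mem_closure_of_im_eq [NumberField K] (ht : 0 < t) {L : Set (Manifold σ U)}
    {z₀ : Cover σ} (hL : L = {q | Relation.EqvGen TangentJoined (proj σ U z₀) q})
    {z : Cover σ} (hz : ∀ i, (z.1.1 i).im = (z₀.1.1 i).im) : proj σ U z ∈ closure L := by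
  have key : z ∈ closure (proj σ U ⁻¹' L) := by
    have hind : IsInducing (fun z : Cover σ => z.1) := IsInducing.subtypeVal
    rw [hind.closure_eq_preimage_closure_image]
    refine Metric.mem_closure_iff.mpr fun ε hε => ?_
    obtain ⟨a, ha⟩ := exists_integer_re_near ht σ (fun i => (z.1.1 i).re - (z₀.1.1 i).re) hε
    let y : Cover σ := ⟨(fun i => z₀.1.1 i + (σ.re i (a : K) : ℂ), z.1.2), fun i => by
      simpa using z₀.2 i⟩
    refine ⟨y.1, ⟨y, ?_, rfl⟩, ?_⟩
    · rw [Set.mem_preimage, hL, Set.mem_ofPred_eq, ← proj_affineAct a 1 z₀]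
      refine .rel _ _ (tangentJoined_of_fst_eq ?_)
      ext i
      simp [affineAct, unitVal_one, y]
    · rw [Prod.dist_eq, max_lt_iff]
      refine ⟨(dist_pi_lt_iff hε).mpr fun i => ?_, by simpa [y] using hε⟩
      have h : z.1.1 i - y.1.1 i =
          (((z.1.1 i).re - (z₀.1.1 i).re - σ.re i (a : K) : ℝ) : ℂ) := by
        apply Complex.ext <;> simp [y, hz i]
        ring
      rw [dist_eq_norm, h, Complex.norm_real]
      exact ha i
  exact continuous_proj.closure_preimage_subset L key

end OT

theorem mainTheorem3 {K : Type*} [Field K] [NumberField K] {s t : ℕ} (ht : 0 < t)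
    (σ : OT.Embeddings K s t) (U : Subgroup (OT.positiveUnits K)) (hU : OT.IsAdmissible σ U)
    (L : Set (OT.Manifold σ U)) (hL : OT.IsLeaf L) :
    (∃ α : Fin s → ℝ, (∀ i, 0 < α i) ∧
      {z : OT.Cover σ | ∀ i, (z.1.1 i).im = α i} ⊆ OT.proj σ U ⁻¹' closure L) ∧
    (∀ X : Set (OT.Manifold σ U), OT.IsSubvariety X → closure L ⊆ X → X = Set.univ) := by
  obtain ⟨p, hL⟩ := hL
  obtain ⟨z₀, rfl⟩ := OT.proj_surjective p
  have hcl : ∀ z : OT.Cover σ, (∀ i, (z.1.1 i).im = (z₀.1.1 i).im) →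
      OT.proj σ U z ∈ closure L := fun z hz => OT.proj_mem_closure_of_im_eq ht hL hz
  exact ⟨⟨fun i => (z₀.1.1 i).im, z₀.2, hcl⟩,
    fun X hX hLX => hX.eq_univ_of_im_eq z₀.2 fun z hz => hLX (hcl z hz)⟩
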